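/- Let $\mathbb{K}$ be a field and let $V$ be a finite set. A $3$-uniform clutter on $V$ is a collection $\mathcal{C}$ of $3$-element subsets of $V$ (its circuits) whose union is $V$; its complement $\bar{\mathcal{C}}$ is the collection of all $3$-element subsets of $V$ not in $\mathcal{C}$, and its edge ideal is $I=I(\mathcal{C})=\left(\prod_{v\in T}x_v : T\in\mathcal{C}\right)\subseteq \mathbb{K}[x_v : v\in V]$. Write $abc$ for $\{a,b,c\}$ and let $\mathscr{C}=\{\mathcal{B},\mathcal{B}_1,\mathcal{B}_2,\mathcal{B}'\}$, where $$\mathcal{B}=\{123,124,134,235,245,345\},\quad \mathcal{B}_1=\mathcal{B}\cup\{125\},\quad \mathcal{B}_2=\mathcal{B}\cup\{125,135\},\quad \mathcal{B}'=\binom{\{1,\dots,6\}}{3}\setminus\{123,456\}.$$ The collection $\bar{\mathcal{C}}$ is called $\mathscr{C}$-free if there is no $W\subseteq V$ for which the induced collection $\{F\in\bar{\mathcal{C}} : F\subseteq W\}$ is isomorphic to a member of $\mathscr{C}$ (isomorphic by a bijection between the unions of the circuits). For a monomial ideal $J$ let $\beta_{i,j}(J)$ be its graded Betti numbers, that is,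 the number of basis elements of degree $j$ in homological position $i$ of the minimal multigraded free resolution of $J$. Call $J$ $r$-step linear if, for some $d$, $J$ is generated by homogeneous elements of degree $d$ and $\beta_{i,j}(J)=0$ for all $0\le i\le r$ and $j>i+d$, and put $\mathrm{index}(J)=\sup\{r\ge 0 : J \text{ is } r\text{-step linear}\}+1\in\mathbb{N}\cup\{\infty\}$. Then $\bar{\mathcal{C}}$ is $\mathscr{C}$-free if and only if $\mathrm{index}(I^k)>1$ for some $k\ge 1$. Moreover, if $\bar{\mathcal{C}}$ is not $\mathscr{C}$-free, then every power $I^k$ with $k\ge 1$ has a nonlinear first syzygy, that is, $\beta_{1,j}(I^k)\neq 0$ for some $j>3k+1$. -/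

import Mathlib

open MvPolynomial

/-- A family `C` of subsets of the finite set `V` is a clutter on the vertex set `V`: the circuits
cover `V` and no circuit contains another one. -/
def IsClutter {V : Type*} [Fintype V] [DecidableEq V] (C : Finset (Finset V)) : Prop :=
  C.sup id = Finset.univ ∧ ∀ F ∈ C, ∀ G ∈ C, F ⊆ G → F = G

/-- Every circuit has exactly `d` vertices. -/
def IsUniform {V : Type*} (d : ℕ) (C : Finset (Finset V)) : Prop :=
  ∀ F ∈ C, F.card = d

/-- The complement of a `d`-uniform clutter: the `d`-subsets of `V` that are not circuits. -/
def clutterComplement {V : Type*} [Fintype V] [DecidableEq V] (d : ℕ) (C : Finset (Finset V)) :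
    Finset (Finset V) :=
  Finset.univ.powersetCard d \ C

/-- The induced subfamily `C[W]`: the circuits contained in `W`. -/
def inducedSubclutter {V : Type*} [DecidableEq V] (C : Finset (Finset V)) (W : Finset V) :
    Finset (Finset V) :=
  C.filter (fun F => F ⊆ W)

/-- Two clutters, each on the union of its circuits as vertex set, are isomorphic: some map is
injective on the vertices of `C` and carries the circuits of `C` exactly onto those of `D`. -/
def ClutterIso {U V : Type*} [DecidableEq U] [DecidableEq V]
    (C : Finset (Finset U)) (D : Finset (Finset V)) : Prop :=
  ∃ f : U → V, Set.InjOn f (C.sup id : Finset U) ∧ C.image (fun F => F.image f) = D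

/-- `C` has no induced subclutter isomorphic to a member of the family `𝓕`. -/
def IsFamilyFree {U V : Type*} [DecidableEq U] [DecidableEq V]
    (𝓕 : Set (Finset (Finset U))) (C : Finset (Finset V)) : Prop :=
  ∀ D ∈ 𝓕, ∀ W : Finset V, ¬ ClutterIso D (inducedSubclutter C W)

/-- The bi-pyramid with apexes `1`, `5` over the (missing) triangle `234`. -/
def bipyramid : Finset (Finset ℕ) :=
  {{1, 2, 3}, {1, 2, 4}, {1, 3, 4}, {2, 3, 5}, {2, 4, 5}, {3, 4, 5}}

/-- The bi-pyramid together with `125`. -/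
def bipyramidOne : Finset (Finset ℕ) := bipyramid ∪ {{1, 2, 5}}

/-- The bi-pyramid together with `125` and `135`. -/
def bipyramidTwo : Finset (Finset ℕ) := bipyramid ∪ {{1, 2, 5}, {1, 3, 5}}

/-- All triples of `{1, …, 6}` except `123` and `456`. -/
def sixPointClutter : Finset (Finset ℕ) :=
  (Finset.Icc 1 6).powersetCard 3 \ {{1, 2, 3}, {4, 5, 6}}

/-- The family of the four forbidden clutters. -/
def forbiddenFamily : Set (Finset (Finset ℕ)) :=
  {bipyramid, bipyramidOne, bipyramidTwo, sixPointClutter}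

/-- The edge ideal, generated by the square-free monomials of the circuits. -/
noncomputable def edgeIdeal (K : Type*) [Field K] {V : Type*} (C : Finset (Finset V)) :
    Ideal (MvPolynomial V K) :=
  Ideal.span {f | ∃ T ∈ C, f = ∏ v ∈ T, X v}

/-- A multigraded resolution `⋯ → F₂ → F₁ → F₀ → I → 0` by finitely generated free modules over the
polynomial ring `S`, where `F i = ⨁ b, S (-(deg i b))` is given by its homogeneous basis. (The
multidegrees of a monomial ideal, hence those of its minimal resolution, have nonnegative
entries.) -/
structure MultigradedResolution {K : Type*} [Field K] {V : Type*}
    (I : Ideal (MvPolynomial V K)) where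
  /-- the rank of `F i` -/
  rank : ℕ → ℕ
  /-- the multidegrees of the basis of `F i` -/
  deg : ∀ i, Fin (rank i) → (V →₀ ℕ)
  /-- the map `F 0 → S` with image `I` -/
  aug : (Fin (rank 0) → MvPolynomial V K) →ₗ[MvPolynomial V K] MvPolynomial V K
  /-- the differential `F (i + 1) → F i` -/
  diff : ∀ i, (Fin (rank (i + 1)) → MvPolynomial V K) →ₗ[MvPolynomial V K]
    (Fin (rank i) → MvPolynomial V K)
  /-- `aug` preserves multidegrees -/
  aug_homogeneous : ∀ b, ∀ m ∈ (aug (Pi.single b 1)).support, m = deg 0 b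
  /-- the differentials preserve multidegrees -/
  diff_homogeneous : ∀ i b b', ∀ m ∈ (diff i (Pi.single b 1) b').support,
    m + deg i b' = deg (i + 1) b
  range_aug : LinearMap.range aug = I
  exact_zero : Function.Exact (diff 0) aug
  exact_succ : ∀ i, Function.Exact (diff (i + 1)) (diff i)

/-- A resolution is minimal when each differential maps into `𝔪 F i`, where `𝔪` is the ideal
generated by the variables. -/
def MultigradedResolution.IsMinimal {K : Type*} [Field K] {V : Type*}
    {I : Ideal (MvPolynomial V K)} (F : MultigradedResolution I) : Prop :=
  ∀ i x b, constantCoeff (F.diff i x b) = 0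

open Classical in
/-- The multigraded Betti number `β_{i,a}(I)` of a monomial ideal `I`: the number of copies of
`S(-a)` in the `i`-th module of the minimal multigraded free resolution of `I`, which exists and is
unique up to isomorphism. (The value is `0` for ideals that have no multigraded resolution, which
are not monomial.) -/
noncomputable def multigradedBetti {K : Type*} [Field K] {V : Type*}
    (I : Ideal (MvPolynomial V K)) (i : ℕ) (a : V →₀ ℕ) : ℕ :=
  if h : ∃ F : MultigradedResolution I, F.IsMinimal then
    (Finset.univ.filter (fun b => h.choose.deg i b = a)).card
  else 0

/-- The graded Betti number `β_{i,j}(I)`, the sum of the `β_{i,a}(I)` over all `a` with `|a| = j`. -/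
noncomputable def gradedBetti {K : Type*} [Field K] {V : Type*} [Fintype V] [DecidableEq V]
    (I : Ideal (MvPolynomial V K)) (i j : ℕ) : ℕ :=
  ∑ a ∈ (Finset.univ : Finset V).finsuppAntidiag j, multigradedBetti I i a

/-- `I` is generated by homogeneous elements of degree `d`. -/
def IsGeneratedInDegree {K : Type*} [Field K] {V : Type*}
    (I : Ideal (MvPolynomial V K)) (d : ℕ) : Prop :=
  ∃ G : Set (MvPolynomial V K), (∀ f ∈ G, f.IsHomogeneous d) ∧ Ideal.span G = I

/-- `I` has a linear resolution up to homological degree `r`. -/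
def IsStepLinear {K : Type*} [Field K] {V : Type*} [Fintype V] [DecidableEq V]
    (I : Ideal (MvPolynomial V K)) (r : ℕ) : Prop :=
  ∃ d, IsGeneratedInDegree I d ∧ ∀ i ≤ r, ∀ j, i + d < j → gradedBetti I i j = 0

/-- The Green–Lazarsfeld index `sup {r | I is r-step linear} + 1`, possibly infinite. -/
noncomputable def greenLazarsfeldIndex {K : Type*} [Field K] {V : Type*} [Fintype V]
    [DecidableEq V] (I : Ideal (MvPolynomial V K)) : ℕ∞ :=
  sSup {r : ℕ∞ | ∃ n : ℕ, r = n ∧ IsStepLinear I n} + 1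

/-! For an ideal generated by monomials of degree `d`, the first syzygies are linear exactly when
any two generators `u`, `v` are joined by a path of generators dividing `lcm(u, v)` in which
consecutive lcms have degree at most `d + 1`. One direction is `IsMinimal.degree_deg_one_le`, the
other `IsMinimal.reflTransGen_linearStep`. Both directions work with an arbitrary minimal
multigraded resolution, so only existence of one is needed, not uniqueness.

For `k = 1` a step joins circuits sharing two vertices. If the complement is free, two circuits
meeting in one vertex are joined inside their five-point union, since otherwise a bi-pyramid type
appears; two disjoint circuits are joined through a third circuit in their union, since otherwise
the six-point clutter appears (`reflTransGen_circuitStep`).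

Conversely, each forbidden clutter has twins: vertices `p`, `q` that every circuit of `C` inside a
set `U` contains both or neither of, with circuits `T₁`, `T₂` in `U` of the two kinds. Any generator
of `I^k` dividing the lcm of the `k`-th powers of these two monomials is a product of circuits
inside `U`, so its exponents at `p` and `q` agree. A linear step trades one variable for another and
cannot change both, so the exponent at `p` is constant along paths; but it is `k` at one end and `0`
at the other. Hence every power has a nonlinear first syzygy. -/

/-! ### Existence of minimal multigraded resolutions of monomial ideals. -/

section GradedFreeModules

variable {K : Type*} [Field K] {V : Type*}

/-- The element `g` of `⨁ b, S (-(deg b))` is homogeneous of multidegree `a`. -/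
def IsMultihomogeneous {n : ℕ} (deg : Fin n → (V →₀ ℕ)) (a : V →₀ ℕ)
    (g : Fin n → MvPolynomial V K) : Prop :=
  ∀ b, ∀ m ∈ (g b).support, m + deg b = a

open Classical in
/-- The component of multidegree `a` of an element of `⨁ b, S (-(deg b))`. -/
noncomputable def gradedPart {n : ℕ} (deg : Fin n → (V →₀ ℕ)) (a : V →₀ ℕ) :
    (Fin n → MvPolynomial V K) →ₗ[K] (Fin n → MvPolynomial V K) :=
  LinearMap.pi fun b =>
    if deg b ≤ a then monomial (a - deg b) ∘ₗ lcoeff K (a - deg b) ∘ₗ LinearMap.proj b else 0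

open Classical in
theorem coeff_gradedPart {n : ℕ} (deg : Fin n → (V →₀ ℕ)) (a : V →₀ ℕ)
    (g : Fin n → MvPolynomial V K) (b : Fin n) (m : V →₀ ℕ) :
    coeff m (gradedPart deg a g b) = if m + deg b = a then coeff m (g b) else 0 := by
  unfold gradedPart
  simp only [LinearMap.pi_apply]
  split_ifs with h1 h2 h2
  · subst h2; simp
  · have : a - deg b ≠ m := by
      rintro rfl
      exact h2 (tsub_add_cancel_of_le h1)
    simp [coeff_monomial, this]
  · exact absurd (h2 ▸ le_add_self) h1
  · simp

theorem isMultihomogeneous_gradedPart {n : ℕ} (deg : Fin n → (V →₀ ℕ)) (a : V →₀ ℕ)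
    (g : Fin n → MvPolynomial V K) : IsMultihomogeneous deg a (gradedPart deg a g) := by
  classical
  intro b m hm
  rw [mem_support_iff, coeff_gradedPart] at hm
  by_contra h
  simp [h] at hm

open Classical in
theorem IsMultihomogeneous.gradedPart_eq {n : ℕ} {deg : Fin n → (V →₀ ℕ)} {a : V →₀ ℕ}
    {g : Fin n → MvPolynomial V K} (hg : IsMultihomogeneous deg a g) (a' : V →₀ ℕ) :
    gradedPart deg a' g = if a' = a then g else 0 := by
  funext b
  ext m
  rw [coeff_gradedPart]
  by_cases hm : coeff m (g b) = 0
  · split_ifs <;> simp [hm]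
  · rw [hg b m (mem_support_iff.2 hm)]
    by_cases h : a' = a
    · simp [h]
    · simp [h, Ne.symm h]

theorem IsMultihomogeneous.monomial_smul {n : ℕ} {deg : Fin n → (V →₀ ℕ)} {a : V →₀ ℕ}
    {g : Fin n → MvPolynomial V K} (hg : IsMultihomogeneous deg a g) (m : V →₀ ℕ) (c : K) :
    IsMultihomogeneous deg (m + a) (monomial m c • g) := by
  classical
  intro b m' hm'
  rw [Pi.smul_apply, smul_eq_mul, mem_support_iff, coeff_monomial_mul'] at hm'
  split_ifs at hm' with h
  · have := hg b (m' - m) (mem_support_iff.2 (right_ne_zero_of_mul hm'))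
    rw [← this, ← add_assoc, add_tsub_cancel_of_le h]
  · exact absurd rfl hm'

theorem isMultihomogeneous_single {n : ℕ} (deg : Fin n → (V →₀ ℕ)) (b : Fin n) :
    IsMultihomogeneous deg (deg b) (Pi.single b (1 : MvPolynomial V K)) := by
  classical
  intro b' m hm
  by_cases h : b' = b
  · subst h
    simp only [Pi.single_eq_same, support_one, Finset.mem_singleton] at hm
    simp [hm]
  · simp [h] at hm

theorem sum_gradedPart {n : ℕ} (deg : Fin n → (V →₀ ℕ)) (g : Fin n → MvPolynomial V K) :
    ∃ s : Finset (V →₀ ℕ), g = ∑ a ∈ s, gradedPart deg a g := by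
  classical
  refine ⟨Finset.univ.biUnion fun b => (g b).support.image fun m => m + deg b, ?_⟩
  funext b
  ext m
  rw [Finset.sum_apply, coeff_sum]
  simp only [coeff_gradedPart]
  rw [Finset.sum_ite_eq]
  split_ifs with h
  · rfl
  · by_contra hm
    exact h (Finset.mem_biUnion.2 ⟨b, Finset.mem_univ _,
      Finset.mem_image.2 ⟨m, mem_support_iff.2 hm, rfl⟩⟩)

theorem map_gradedPart {n n' : ℕ} {deg : Fin n → (V →₀ ℕ)} {deg' : Fin n' → (V →₀ ℕ)}
    (φ : (Fin n' → MvPolynomial V K) →ₗ[MvPolynomial V K] (Fin n → MvPolynomial V K))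
    (hφ : ∀ b, IsMultihomogeneous deg (deg' b) (φ (Pi.single b 1))) (a : V →₀ ℕ)
    (g : Fin n' → MvPolynomial V K) :
    φ (gradedPart deg' a g) = gradedPart deg a (φ g) := by
  classical
  suffices h : (φ.restrictScalars K) ∘ₗ gradedPart deg' a
      = gradedPart deg a ∘ₗ (φ.restrictScalars K) from LinearMap.congr_fun h g
  refine LinearMap.pi_ext' fun b => (basisMonomials V K).ext fun m => ?_
  have hs : (Pi.single b (monomial m (1 : K)) : Fin n' → MvPolynomial V K)
      = monomial m (1 : K) • Pi.single b 1 := by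
    rw [← Pi.single_smul, smul_eq_mul, mul_one]
  simp only [LinearMap.comp_apply, LinearMap.coe_single, LinearMap.restrictScalars_apply,
    coe_basisMonomials]
  rw [hs, ((isMultihomogeneous_single deg' b).monomial_smul m 1).gradedPart_eq, map_smul,
    ((hφ b).monomial_smul m 1).gradedPart_eq]
  split_ifs <;> simp

variable [Finite V]

variable (K V) in
/-- A multigraded submodule of a finitely generated multigraded free module. -/
structure MultigradedSubmodule where
  rank : ℕ
  deg : Fin rank → (V →₀ ℕ)
  carrier : Submodule (MvPolynomial V K) (Fin rank → MvPolynomial V K)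
  gradedPart_mem : ∀ g ∈ carrier, ∀ a, gradedPart deg a g ∈ carrier

theorem MultigradedSubmodule.exists_generators (N : MultigradedSubmodule K V) :
    ∃ (m : ℕ) (g : Fin m → (Fin N.rank → MvPolynomial V K)),
      (∀ i, ∃ a, IsMultihomogeneous N.deg a (g i)) ∧
      Submodule.span (MvPolynomial V K) (Set.range g) = N.carrier := by
  classical
  obtain ⟨t, ht⟩ := (IsNoetherian.noetherian N.carrier : N.carrier.FG)
  have key : ∃ t : Finset (Fin N.rank → MvPolynomial V K),
      (∀ g ∈ t, ∃ a, IsMultihomogeneous N.deg a g) ∧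
      Submodule.span (MvPolynomial V K) (t : Set _) = N.carrier := by
    choose s hs using sum_gradedPart (K := K) N.deg
    refine ⟨t.biUnion fun g => (s g).image fun a => gradedPart N.deg a g, ?_, ?_⟩
    · intro g hg
      simp only [Finset.mem_biUnion, Finset.mem_image] at hg
      obtain ⟨g', -, a, -, rfl⟩ := hg
      exact ⟨a, isMultihomogeneous_gradedPart _ _ _⟩
    · apply le_antisymm
      · rw [Submodule.span_le]
        intro g hg
        simp only [Finset.coe_biUnion, Finset.coe_image, Set.mem_iUnion, Set.mem_image,
          Finset.mem_coe, exists_prop] at hg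
        obtain ⟨g', hg', a, -, rfl⟩ := hg
        exact N.gradedPart_mem _ (ht ▸ Submodule.subset_span hg') _
      · rw [← ht, Submodule.span_le]
        intro g hg
        rw [hs g]
        refine Submodule.sum_mem _ fun a ha => Submodule.subset_span ?_
        simp only [Finset.coe_biUnion, Finset.coe_image, Set.mem_iUnion, Set.mem_image,
          Finset.mem_coe, exists_prop]
        exact ⟨g, hg, a, ha, rfl⟩
  obtain ⟨t, h1, h2⟩ := key
  refine ⟨t.card, fun i => (t.equivFin.symm i : _), fun i => h1 _ (t.equivFin.symm i).2, ?_⟩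
  rw [← h2]
  congr 1
  ext g
  constructor
  · rintro ⟨i, rfl⟩
    exact (t.equivFin.symm i).2
  · intro hg
    exact ⟨t.equivFin ⟨g, hg⟩, by simp⟩

/-- A graded Nakayama argument: with the least possible number of homogeneous generators, a relation
having a unit entry would make one generator redundant. -/
theorem MultigradedSubmodule.exists_minimal_cover (N : MultigradedSubmodule K V) :
    ∃ (N' : MultigradedSubmodule K V)
      (φ : (Fin N'.rank → MvPolynomial V K) →ₗ[MvPolynomial V K]
        (Fin N.rank → MvPolynomial V K)),
      (∀ b, IsMultihomogeneous N.deg (N'.deg b) (φ (Pi.single b 1))) ∧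
      LinearMap.range φ = N.carrier ∧ LinearMap.ker φ = N'.carrier ∧
      ∀ y ∈ N'.carrier, ∀ b, constantCoeff (y b) = 0 := by
  classical
  obtain ⟨m, ⟨g, hg, hspan⟩, hmin⟩ : ∃ m, (∃ g : Fin m → (Fin N.rank → MvPolynomial V K),
      (∀ i, ∃ a, IsMultihomogeneous N.deg a (g i)) ∧
      Submodule.span (MvPolynomial V K) (Set.range g) = N.carrier) ∧ ∀ m' < m,
      ¬ ∃ g : Fin m' → (Fin N.rank → MvPolynomial V K),
      (∀ i, ∃ a, IsMultihomogeneous N.deg a (g i)) ∧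
      Submodule.span (MvPolynomial V K) (Set.range g) = N.carrier :=
    ⟨_, Nat.find_spec N.exists_generators, fun _ h => Nat.find_min N.exists_generators h⟩
  choose deg' hdeg' using hg
  set φ := Fintype.linearCombination (MvPolynomial V K) g with hφ
  have hφ1 : ∀ b, φ (Pi.single b 1) = g b := fun b => by
    rw [hφ, Fintype.linearCombination_apply_single, one_smul]
  have hhom : ∀ b, IsMultihomogeneous N.deg (deg' b) (φ (Pi.single b 1)) := fun b => by
    rw [hφ1]; exact hdeg' b
  refine ⟨⟨m, deg', LinearMap.ker φ, fun y hy a => ?_⟩, φ, hhom, ?_, rfl, ?_⟩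
  · rw [LinearMap.mem_ker] at hy ⊢
    rw [map_gradedPart φ hhom, hy, map_zero]
  · exact (Fintype.range_linearCombination _ _).trans hspan
  · intro y hy b
    change Fin m → MvPolynomial V K at y
    change Fin m at b
    change φ y = 0 at hy
    by_contra hc
    -- In multidegree `deg' b` the `b`-th entry of the relation is just its constant term, so `g b`
    -- can be solved for.
    set z := gradedPart deg' (deg' b) y with hz
    have hφz : φ z = 0 := by rw [hz, map_gradedPart φ hhom, hy, map_zero]
    have hzb : z b = C (constantCoeff (y b)) := by
      ext k
      rw [hz, coeff_gradedPart, coeff_C, constantCoeff_eq]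
      by_cases hk : k = 0
      · simp [hk]
      · simp [hk, Ne.symm hk]
    obtain ⟨m, rfl⟩ : ∃ m', m = m' + 1 := ⟨m - 1, by have := b.pos; omega⟩
    refine hmin m (Nat.lt_succ_self m)
      ⟨fun i => g (b.succAbove i), fun i => ⟨_, hdeg' _⟩, ?_⟩
    rw [← hspan]
    apply le_antisymm
    · apply Submodule.span_mono
      rintro _ ⟨i, rfl⟩
      exact ⟨_, rfl⟩
    · rw [Submodule.span_le]
      rintro _ ⟨i, rfl⟩
      have hmem : ∀ j, j ≠ b → g j ∈ Submodule.span (MvPolynomial V K)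
          (Set.range fun i => g (b.succAbove i)) := fun j hj => by
        obtain ⟨k, rfl⟩ := Fin.exists_succAbove_eq hj
        exact Submodule.subset_span ⟨k, rfl⟩
      by_cases hib : i = b
      · subst hib
        rw [hφ, Fintype.linearCombination_apply, Fin.sum_univ_succAbove _ i, hzb,
          add_eq_zero_iff_eq_neg] at hφz
        have h2 : g i = C (σ := V) (constantCoeff (y i))⁻¹ • (C (σ := V) (constantCoeff (y i)) • g i) := by
          rw [smul_smul, ← C_mul, inv_mul_cancel₀ hc, C_1, one_smul]
        rw [SetLike.mem_coe, h2, hφz]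
        refine Submodule.smul_mem _ _ (Submodule.neg_mem _ (Submodule.sum_mem _ fun j _ =>
          Submodule.smul_mem _ _ (hmem _ (Fin.succAbove_ne _ _))))
      · exact hmem i hib

/-- The kernel of a minimal multigraded free cover. -/
noncomputable def MultigradedSubmodule.syzygy (N : MultigradedSubmodule K V) :
    MultigradedSubmodule K V :=
  N.exists_minimal_cover.choose

/-- A minimal multigraded free cover. -/
noncomputable def MultigradedSubmodule.cover (N : MultigradedSubmodule K V) :
    (Fin N.syzygy.rank → MvPolynomial V K) →ₗ[MvPolynomial V K]
      (Fin N.rank → MvPolynomial V K) :=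
  N.exists_minimal_cover.choose_spec.choose

theorem MultigradedSubmodule.cover_spec (N : MultigradedSubmodule K V) :
    (∀ b, IsMultihomogeneous N.deg (N.syzygy.deg b) (N.cover (Pi.single b 1))) ∧
      LinearMap.range N.cover = N.carrier ∧ LinearMap.ker N.cover = N.syzygy.carrier ∧
      ∀ y ∈ N.syzygy.carrier, ∀ b, constantCoeff (y b) = 0 :=
  N.exists_minimal_cover.choose_spec.choose_spec

/-- The ideal generated by the monomials with exponents in `M`. -/
noncomputable def monomialIdeal (K : Type*) [Field K] {V : Type*} (M : Set (V →₀ ℕ)) :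
    Ideal (MvPolynomial V K) :=
  Ideal.span ((fun s => monomial s (1 : K)) '' M)

/-- A monomial ideal as a multigraded submodule of the free module of rank one. -/
noncomputable def monomialSubmodule (K : Type*) [Field K] {V : Type*} [Finite V]
    (M : Set (V →₀ ℕ)) : MultigradedSubmodule K V where
  rank := 1
  deg := fun _ => 0
  carrier := Submodule.comap (LinearMap.proj (R := MvPolynomial V K)
    (φ := fun _ : Fin 1 => MvPolynomial V K) 0) (monomialIdeal K M)
  gradedPart_mem := by
    classical
    intro g hg a
    rw [Submodule.mem_comap] at hg ⊢
    simp only [LinearMap.proj_apply, monomialIdeal, mem_ideal_span_monomial_image] at hg ⊢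
    intro m hm
    refine hg m ?_
    rw [mem_support_iff, coeff_gradedPart] at hm
    rw [mem_support_iff]
    split_ifs at hm
    · exact hm
    · exact absurd rfl hm

variable (K) in
/-- The iterated syzygy modules of a monomial ideal. -/
noncomputable def monomialSyzygy (M : Set (V →₀ ℕ)) : ℕ → MultigradedSubmodule K V
  | 0 => monomialSubmodule K M
  | i + 1 => (monomialSyzygy M i).syzygy

/-- `N 0` is the ideal inside a free module of rank one, identified with the ring by `π`; `N (i +
1)` lies in the free module that becomes `F i`. The existential keeps the recursive construction
opaque afterwards. -/
theorem exists_minimal_covers (M : Set (V →₀ ℕ)) :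
    ∃ (N : ℕ → MultigradedSubmodule K V)
      (d : ∀ i, (Fin (N (i + 1)).rank → MvPolynomial V K) →ₗ[MvPolynomial V K]
        (Fin (N i).rank → MvPolynomial V K))
      (π : (Fin (N 0).rank → MvPolynomial V K) →ₗ[MvPolynomial V K] MvPolynomial V K),
      (∀ i b, IsMultihomogeneous (N i).deg ((N (i + 1)).deg b) (d i (Pi.single b 1))) ∧
      (∀ i x, d i x = 0 ↔ x ∈ Set.range (d (i + 1))) ∧
      (∀ i x b, constantCoeff (d (i + 1) x b) = 0) ∧
      (∀ a x, IsMultihomogeneous (N 0).deg a x → ∀ m ∈ (π x).support, m = a) ∧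
      (∀ x, π x = 0 ↔ x = 0) ∧
      LinearMap.range (π ∘ₗ d 0) = monomialIdeal K M := by
  refine ⟨monomialSyzygy K M, fun i => (monomialSyzygy K M i).cover,
    LinearMap.proj (R := MvPolynomial V K) (φ := fun _ : Fin 1 => MvPolynomial V K) 0,
    fun i => (monomialSyzygy K M i).cover_spec.1, fun i x => ?_, fun i x b => ?_,
    fun a x hx m hm => ?_, fun x => ⟨fun h => ?_, ?_⟩, ?_⟩
  · exact (SetLike.ext_iff.1 (monomialSyzygy K M i).cover_spec.2.2.1 x).trans
      (SetLike.ext_iff.1 (monomialSyzygy K M (i + 1)).cover_spec.2.1 x).symm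
  · refine (monomialSyzygy K M i).cover_spec.2.2.2 _ ?_ b
    exact (SetLike.ext_iff.1 (monomialSyzygy K M (i + 1)).cover_spec.2.1 _).1 ⟨x, rfl⟩
  · rw [← hx (0 : Fin 1) m hm]
    exact (add_zero m).symm
  · funext i
    change Fin 1 at i
    rw [Subsingleton.elim i 0]
    exact h
  · rintro rfl
    rfl
  · refine (LinearMap.range_comp _ _).trans ?_
    refine (congrArg _ (monomialSyzygy K M 0).cover_spec.2.1).trans ?_
    exact Submodule.map_comap_eq_of_surjective (fun x => ⟨fun _ => x, rfl⟩) _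

theorem exists_minimal_multigradedResolution (M : Set (V →₀ ℕ)) :
    ∃ F : MultigradedResolution (monomialIdeal K M), F.IsMinimal := by
  obtain ⟨N, d, π, h1, h2, h3, h4, h5, h6⟩ := exists_minimal_covers (K := K) M
  exact ⟨{ rank := fun i => (N (i + 1)).rank
           deg := fun i => (N (i + 1)).deg
           aug := π ∘ₗ d 0
           diff := fun i => d (i + 1)
           aug_homogeneous := fun b => h4 _ _ (h1 0 b)
           diff_homogeneous := fun i => h1 (i + 1)
           range_aug := h6
           exact_zero := fun x => (h5 _).trans (h2 0 x)
           exact_succ := fun i x => h2 (i + 1) x }, h3⟩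

end GradedFreeModules

/-! ### Linear first syzygies and paths between generators. -/

section LinearRelations

variable {K : Type*} [Field K] {V : Type*}

theorem Finsupp.eq_of_le_of_degree_le {u w : V →₀ ℕ} (h : u ≤ w) (hd : w.degree ≤ u.degree) :
    u = w := by
  have h1 : w.degree = (w - u).degree + u.degree := by
    rw [← map_add, tsub_add_cancel_of_le h]
  have h2 : w - u = 0 := (Finsupp.degree_eq_zero_iff _).1 (by omega)
  exact le_antisymm h (tsub_eq_zero_iff_le.1 h2)

theorem LinearMap.apply_eq_sum_single {R N ι : Type*} [CommSemiring R] [AddCommMonoid N]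
    [Module R N] [Fintype ι] [DecidableEq ι] (f : (ι → R) →ₗ[R] N) (x : ι → R) :
    f x = ∑ i, x i • f (Pi.single i 1) := by
  conv_lhs => rw [← (Pi.basisFun R ι).sum_repr x]
  simp

theorem eq_monomial_of_support {p : MvPolynomial V K} {a : V →₀ ℕ}
    (h : ∀ m ∈ p.support, m = a) : p = monomial a (coeff a p) := by
  classical
  ext m
  rw [coeff_monomial]
  split_ifs with hm
  · rw [hm]
  · by_contra hc
    exact hm (h m (mem_support_iff.2 hc)).symm

/-- One step between exponents of generators dividing `a` whose least common multiple has degree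
at most `d + 1`. -/
def LinearStep (M : Set (V →₀ ℕ)) (d : ℕ) (a w w' : V →₀ ℕ) : Prop :=
  w' ∈ M ∧ w' ≤ a ∧ (w ⊔ w').degree ≤ d + 1

namespace MultigradedResolution

variable {M : Set (V →₀ ℕ)} (F : MultigradedResolution (monomialIdeal K M))

/-- The coefficient of the generator that is the image of a basis element. -/
noncomputable def augCoeff (b : Fin (F.rank 0)) : K :=
  coeff (F.deg 0 b) (F.aug (Pi.single b 1))

theorem aug_single (b : Fin (F.rank 0)) :
    F.aug (Pi.single b 1) = monomial (F.deg 0 b) (F.augCoeff b) :=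
  eq_monomial_of_support (F.aug_homogeneous b)

/-- The scalar entries of the matrix of the first differential. -/
noncomputable def diffCoeff (b : Fin (F.rank 1)) (b' : Fin (F.rank 0)) : K :=
  coeff (F.deg 1 b - F.deg 0 b') (F.diff 0 (Pi.single b 1) b')

theorem diff_single (b : Fin (F.rank 1)) (b' : Fin (F.rank 0)) :
    F.diff 0 (Pi.single b 1) b' = monomial (F.deg 1 b - F.deg 0 b') (F.diffCoeff b b') := by
  refine eq_monomial_of_support fun m hm => ?_
  rw [← F.diff_homogeneous 0 b b' m hm, add_tsub_cancel_right]

theorem deg_le_of_diffCoeff_ne_zero {b : Fin (F.rank 1)} {b' : Fin (F.rank 0)}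
    (h : F.diffCoeff b b' ≠ 0) : F.deg 0 b' ≤ F.deg 1 b := by
  rw [← F.diff_homogeneous 0 b b' _ (mem_support_iff.2 h)]
  exact le_add_self

theorem aug_diff (x : Fin (F.rank 1) → MvPolynomial V K) : F.aug (F.diff 0 x) = 0 :=
  (F.exact_zero _).2 ⟨x, rfl⟩

variable {F} (hF : F.IsMinimal)
include hF

theorem IsMinimal.constantCoeff_of_aug_eq_zero {x : Fin (F.rank 0) → MvPolynomial V K}
    (hx : F.aug x = 0) (b : Fin (F.rank 0)) : constantCoeff (x b) = 0 := by
  obtain ⟨y, rfl⟩ := (F.exact_zero x).1 hx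
  exact hF 0 y b

theorem IsMinimal.augCoeff_ne_zero (b : Fin (F.rank 0)) : F.augCoeff b ≠ 0 := by
  intro h
  have := hF.constantCoeff_of_aug_eq_zero (x := Pi.single b 1) (by rw [F.aug_single, h]; simp) b
  simp at this

omit hF in
theorem exists_aug_eq {w : V →₀ ℕ} (hw : w ∈ M) : ∃ x, F.aug x = monomial w 1 := by
  have : monomial w (1 : K) ∈ LinearMap.range F.aug := by
    rw [F.range_aug]
    exact Ideal.subset_span ⟨w, hw, rfl⟩
  exact this

/-- If the image of a basis element were a proper multiple of some `u ∈ M`, subtracting that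
multiple of a lift of `u` would give a syzygy with a unit entry. -/
theorem IsMinimal.deg_zero_mem (b : Fin (F.rank 0)) : F.deg 0 b ∈ M := by
  have h1 := (SetLike.ext_iff.1 F.range_aug _).1 (LinearMap.mem_range_self F.aug (Pi.single b 1))
  rw [F.aug_single] at h1
  obtain ⟨u, hu, hle⟩ := mem_ideal_span_monomial_image.1 h1 (F.deg 0 b) (by classical simp [coeff_monomial, hF.augCoeff_ne_zero b])
  by_contra hb
  have hne : u ≠ F.deg 0 b := fun h => hb (h ▸ hu)
  obtain ⟨y, hy⟩ := exists_aug_eq (F := F) hu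
  have h2 := hF.constantCoeff_of_aug_eq_zero
    (x := Pi.single b 1 - monomial (F.deg 0 b - u) (F.augCoeff b) • y)
    (by rw [map_sub, map_smul, hy, F.aug_single, smul_eq_mul, monomial_mul,
          tsub_add_cancel_of_le hle, mul_one, sub_self]) b
  have h3 : F.deg 0 b - u ≠ 0 := fun h => hne (le_antisymm hle (tsub_eq_zero_iff_le.1 h))
  have h4 : constantCoeff (monomial (F.deg 0 b - u) (F.augCoeff b)) = 0 := by
    classical rw [constantCoeff_monomial, if_neg h3]
  simp [h4] at h2

/-- Basis elements of `F 1` give minimal syzygies: otherwise the basis vector minus an element of `𝔪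
F 1` is a second syzygy with a unit entry. -/
theorem IsMinimal.diff_single_notMem (b : Fin (F.rank 1)) :
    F.diff 0 (Pi.single b 1) ∉
      RingHom.ker (constantCoeff (R := K) (σ := V)) • LinearMap.ker F.aug := by
  intro h
  have key : ∀ x ∈ RingHom.ker (constantCoeff (R := K) (σ := V)) • LinearMap.ker F.aug,
      ∃ y, F.diff 0 y = x ∧ ∀ b, constantCoeff (y b) = 0 := by
    intro x hx
    induction hx using Submodule.smul_induction_on' with
    | smul r hr n hn =>
      obtain ⟨y, rfl⟩ := (F.exact_zero n).1 hn
      refine ⟨r • y, map_smul _ _ _, fun b => ?_⟩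
      rw [RingHom.mem_ker] at hr
      simp [hr]
    | add x _ y _ hx hy =>
      obtain ⟨x', hx, hx'⟩ := hx
      obtain ⟨y', hy, hy'⟩ := hy
      exact ⟨x' + y', by rw [map_add, hx, hy], fun b => by simp [hx', hy']⟩
  obtain ⟨y, hy, hy0⟩ := key _ h
  obtain ⟨w, hw⟩ := (F.exact_succ 0 (Pi.single b 1 - y)).1 (by rw [map_sub, hy, sub_self])
  have h1 := hF 1 w b
  rw [hw] at h1
  simp [hy0] at h1

/-- A basis syzygy of multidegree `a` with `|a| > d + 1` would lie in `P = 𝔪 · ker aug`: modulo `P`,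
all lifts of `x^a` through generators dividing `a` coincide, and the syzygy is a combination of them
whose coefficients sum to zero. -/
theorem IsMinimal.degree_deg_one_le {d : ℕ}
    (hpath : ∀ u ∈ M, ∀ v ∈ M, Relation.ReflTransGen (LinearStep M d (u ⊔ v)) u v)
    (hM : ∀ u ∈ M, u.degree = d)
    (b : Fin (F.rank 1)) : (F.deg 1 b).degree ≤ d + 1 := by
  classical
  by_contra! hlt
  apply hF.diff_single_notMem b
  set P := RingHom.ker (constantCoeff (R := K) (σ := V)) • LinearMap.ker F.aug with hP
  set a := F.deg 1 b with ha
  -- Since `|m| ≤ d + 1 < |a|`, the monomial `x^(a - m)` is not constant.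
  have hmon : ∀ {m : V →₀ ℕ}, m ≤ a → m.degree ≤ d + 1 → ∀ {x}, F.aug x = 0 →
      monomial (a - m) (1 : K) • x ∈ P := by
    intro m hm hmd x hx
    refine Submodule.smul_mem_smul ?_ hx
    rw [RingHom.mem_ker, constantCoeff_monomial, if_neg]
    intro h
    rw [le_antisymm hm (tsub_eq_zero_iff_le.1 h)] at hmd
    omega
  have hf : ∀ w : V →₀ ℕ, ∃ x, w ∈ M → F.aug x = monomial w 1 := fun w => by
    by_cases hw : w ∈ M
    · obtain ⟨x, hx⟩ := exists_aug_eq (F := F) hw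
      exact ⟨x, fun _ => hx⟩
    · exact ⟨0, fun h => absurd h hw⟩
  choose f hf using hf
  -- For `w ∈ M` dividing `a`, this is the lift of `x^a` through the generator `x^w`.
  set T : (V →₀ ℕ) → (Fin (F.rank 0) → MvPolynomial V K) :=
    fun w => monomial (a - w) (1 : K) • f w with hT
  have hstep : ∀ w ∈ M, ∀ w' ∈ M, w ≤ a → w' ≤ a → (w ⊔ w').degree ≤ d + 1 → T w - T w' ∈ P := by
    intro w hw w' hw' hwa hwa' hdeg
    have hle : w ⊔ w' ≤ a := sup_le hwa hwa'
    have h1 := hmon hle hdeg (x := monomial (w ⊔ w' - w) (1 : K) • f w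
      - monomial (w ⊔ w' - w') (1 : K) • f w') (by
        rw [map_sub, map_smul, map_smul, hf w hw, hf w' hw', smul_eq_mul, smul_eq_mul,
          monomial_mul, monomial_mul, tsub_add_cancel_of_le le_sup_left,
          tsub_add_cancel_of_le le_sup_right, sub_self])
    rw [smul_sub, smul_smul, smul_smul, monomial_mul, monomial_mul,
      tsub_add_tsub_cancel hle le_sup_left, tsub_add_tsub_cancel hle le_sup_right, mul_one] at h1
    exact h1
  have hTT : ∀ u ∈ M, ∀ v ∈ M, u ≤ a → v ≤ a → T u - T v ∈ P := by
    intro u hu v hv hua hva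
    have : ∀ w, Relation.ReflTransGen (LinearStep M d (u ⊔ v)) u w →
        w ∈ M ∧ w ≤ a ∧ T u - T w ∈ P := by
      intro w hw
      induction hw with
      | refl => exact ⟨hu, hua, by simp⟩
      | tail _ hs ih =>
        obtain ⟨h1, h2, h3⟩ := ih
        obtain ⟨s1, s2, s3⟩ := hs
        have h4 := s2.trans (sup_le hua hva)
        refine ⟨s1, h4, ?_⟩
        rw [← sub_add_sub_cancel (T u) (T _) (T _)]
        exact add_mem h3 (hstep _ h1 _ s1 h2 h4 s3)
    exact (this v (hpath u hu v hv)).2.2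
  have hbasis : ∀ b', F.deg 0 b' ≤ a →
      monomial (a - F.deg 0 b') (F.augCoeff b')⁻¹ • Pi.single b' 1 - T (F.deg 0 b') ∈ P := by
    intro b' hb'
    have h1 := hmon hb' (by rw [hM _ (hF.deg_zero_mem b')]; omega)
      (x := C (σ := V) (F.augCoeff b')⁻¹ • Pi.single b' 1 - f (F.deg 0 b')) (by
        rw [map_sub, map_smul, F.aug_single, hf _ (hF.deg_zero_mem b'), smul_eq_mul,
          C_mul_monomial, inv_mul_cancel₀ (hF.augCoeff_ne_zero b'), sub_self])
    rw [smul_sub, smul_smul, mul_comm, C_mul_monomial, mul_one] at h1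
    exact h1
  have hsum : F.diff 0 (Pi.single b 1)
      = ∑ b', monomial (a - F.deg 0 b') (F.diffCoeff b b') • Pi.single b' 1 := by
    conv_lhs => rw [← (Pi.basisFun (MvPolynomial V K) _).sum_repr (F.diff 0 (Pi.single b 1))]
    simp [F.diff_single, ha]
  by_cases h0 : ∃ b₀, F.diffCoeff b b₀ ≠ 0
  · obtain ⟨b₀, hb₀⟩ := h0
    have hterm : ∀ b', monomial (a - F.deg 0 b') (F.diffCoeff b b') • Pi.single b' 1
        - C (σ := V) (F.diffCoeff b b' * F.augCoeff b') • T (F.deg 0 b₀) ∈ P := by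
      intro b'
      by_cases hz : F.diffCoeff b b' = 0
      · simp [hz]
      · have hle := F.deg_le_of_diffCoeff_ne_zero hz
        have h1 := P.smul_mem (C (σ := V) (F.diffCoeff b b' * F.augCoeff b')) (add_mem (hbasis b' hle)
          (hTT _ (hF.deg_zero_mem b') _ (hF.deg_zero_mem b₀) hle
            (F.deg_le_of_diffCoeff_ne_zero hb₀)))
        rw [sub_add_sub_cancel, smul_sub, smul_smul, C_mul_monomial, mul_assoc,
          mul_inv_cancel₀ (hF.augCoeff_ne_zero b'), mul_one] at h1
        exact h1
    have hzero : ∑ b', F.diffCoeff b b' * F.augCoeff b' = 0 := by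
      have h1 := F.aug_diff (Pi.single b 1)
      rw [hsum, map_sum] at h1
      have h2 : ∀ b', F.aug (monomial (a - F.deg 0 b') (F.diffCoeff b b') • Pi.single b' 1)
          = monomial a (F.diffCoeff b b' * F.augCoeff b') := by
        intro b'
        by_cases hz : F.diffCoeff b b' = 0
        · simp [hz]
        · rw [map_smul, F.aug_single, smul_eq_mul, monomial_mul,
            tsub_add_cancel_of_le (F.deg_le_of_diffCoeff_ne_zero hz)]
      simp only [h2, ← map_sum] at h1
      exact monomial_eq_zero.1 h1
    have h1 := P.sum_mem (t := Finset.univ) fun b' _ => hterm b'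
    rw [Finset.sum_sub_distrib, ← Finset.sum_smul, ← map_sum, hzero, C_0, zero_smul, sub_zero,
      ← hsum] at h1
    exact h1
  · push Not at h0
    rw [hsum]
    simp [h0]

/-- Let `ψ` be `aug` restricted to the basis elements reachable from `u`. The generators occurring
in a linear syzygy of multidegree dividing `a` are one step apart, so they are all reachable or all
not, and `ψ` kills the syzygy. If `v` is unreachable, the syzygy between `u` and `v` still has image
with coefficient `1` at `x^a`. -/
theorem IsMinimal.reflTransGen_linearStep {d : ℕ} (hM : ∀ u ∈ M, u.degree = d)
    (hdeg : ∀ b, (F.deg 1 b).degree ≤ d + 1) {u v : V →₀ ℕ} (hu : u ∈ M) (hv : v ∈ M) :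
    Relation.ReflTransGen (LinearStep M d (u ⊔ v)) u v := by
  classical
  by_contra hpath
  set a := u ⊔ v with ha
  let comp : Fin (F.rank 0) → Prop := fun b =>
    Relation.ReflTransGen (LinearStep M d a) u (F.deg 0 b)
  let ψ : (Fin (F.rank 0) → MvPolynomial V K) →ₗ[MvPolynomial V K] MvPolynomial V K :=
    F.aug ∘ₗ LinearMap.pi fun b => if comp b then LinearMap.proj b else 0
  have hψ : ∀ x, ψ x = ∑ b, if comp b then x b * monomial (F.deg 0 b) (F.augCoeff b) else 0 := by
    intro x
    simp only [ψ, LinearMap.comp_apply]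
    rw [F.aug.apply_eq_sum_single]
    refine Finset.sum_congr rfl fun b _ => ?_
    rw [F.aug_single, LinearMap.pi_apply]
    split_ifs <;> simp
  have haug : ∀ x, F.aug x = ∑ b, x b * monomial (F.deg 0 b) (F.augCoeff b) := by
    intro x
    rw [F.aug.apply_eq_sum_single]
    simp [F.aug_single]
  have hcoeff : ∀ w ∈ M, ∀ b, F.deg 0 b ≠ w → ∀ p : MvPolynomial V K,
      coeff w (p * monomial (F.deg 0 b) (F.augCoeff b)) = 0 := by
    intro w hw b hb p
    rw [coeff_mul_monomial', if_neg]
    intro hle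
    exact hb (Finsupp.eq_of_le_of_degree_le hle
      (by rw [hM _ hw, hM _ (hF.deg_zero_mem b)]))
  have hrel : ∀ b, F.deg 1 b ≤ a → ψ (F.diff 0 (Pi.single b 1)) = 0 := by
    intro b hb
    by_cases h : ∃ b₀, comp b₀ ∧ F.diffCoeff b b₀ ≠ 0
    · obtain ⟨b₀, hc, hz⟩ := h
      rw [← F.aug_diff (Pi.single b 1), hψ, haug]
      refine Finset.sum_congr rfl fun b' _ => ?_
      split_ifs with hcb
      · rfl
      · rw [F.diff_single]
        by_cases hz' : F.diffCoeff b b' = 0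
        · simp [hz']
        · have h1 := F.deg_le_of_diffCoeff_ne_zero hz
          have h2 := F.deg_le_of_diffCoeff_ne_zero hz'
          exact absurd (hc.tail ⟨hF.deg_zero_mem b', h2.trans hb,
            (Finsupp.degree_mono (sup_le h1 h2)).trans (hdeg b)⟩) hcb
    · push Not at h
      rw [hψ]
      refine Finset.sum_eq_zero fun b' _ => ?_
      split_ifs with hcb
      · rw [F.diff_single, h b' hcb, monomial_zero, zero_mul]
      · rfl
  have hvanish : ∀ x, coeff a (ψ (F.diff 0 x)) = 0 := by
    intro x
    have h1 := (ψ ∘ₗ F.diff 0).apply_eq_sum_single x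
    simp only [LinearMap.comp_apply] at h1
    rw [h1, coeff_sum]
    refine Finset.sum_eq_zero fun b _ => ?_
    by_cases hb : F.deg 1 b ≤ a
    · rw [hrel b hb, smul_zero, coeff_zero]
    -- A syzygy whose multidegree does not divide `a` contributes only multiples of a monomial not
    -- dividing `x^a`.
    · rw [hψ, smul_eq_mul, Finset.mul_sum, coeff_sum]
      refine Finset.sum_eq_zero fun b' _ => ?_
      split_ifs
      · rw [F.diff_single]
        by_cases hz : F.diffCoeff b b' = 0
        · simp [hz]
        · rw [monomial_mul, tsub_add_cancel_of_le (F.deg_le_of_diffCoeff_ne_zero hz),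
            coeff_mul_monomial', if_neg hb]
      · simp
  obtain ⟨fu, hfu⟩ := exists_aug_eq (F := F) hu
  obtain ⟨fv, hfv⟩ := exists_aug_eq (F := F) hv
  obtain ⟨y, hy⟩ := (F.exact_zero (monomial (a - u) (1 : K) • fu - monomial (a - v) (1 : K) • fv)).1
    (by rw [map_sub, map_smul, map_smul, hfu, hfv, smul_eq_mul, smul_eq_mul, monomial_mul,
          monomial_mul, tsub_add_cancel_of_le le_sup_left, tsub_add_cancel_of_le le_sup_right,
          sub_self])
  have h1 := hvanish y
  rw [hy, map_sub, map_smul, map_smul, coeff_sub, smul_eq_mul, smul_eq_mul, coeff_monomial_mul',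
    coeff_monomial_mul', if_pos tsub_le_self, if_pos tsub_le_self,
    tsub_tsub_cancel_of_le le_sup_left, tsub_tsub_cancel_of_le le_sup_right, one_mul, one_mul] at h1
  have hu1 : coeff u (ψ fu) = 1 := by
    have h2 : coeff u (F.aug fu) = 1 := by rw [hfu, coeff_monomial, if_pos rfl]
    rw [← h2, hψ, haug, coeff_sum, coeff_sum]
    refine Finset.sum_congr rfl fun b _ => ?_
    split_ifs with hc
    · rfl
    · rw [coeff_zero, hcoeff u hu b]
      intro h
      exact hc (by simp only [comp, h]; exact Relation.ReflTransGen.refl)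
  have hv0 : coeff v (ψ fv) = 0 := by
    rw [hψ, coeff_sum]
    refine Finset.sum_eq_zero fun b _ => ?_
    split_ifs with hc
    · refine hcoeff v hv b ?_ _
      intro h
      exact hpath (h ▸ hc)
    · rw [coeff_zero]
  rw [hu1, hv0, sub_zero] at h1
  exact one_ne_zero h1

end MultigradedResolution

end LinearRelations

/-! ### Paths of circuits and twins in forbidden clutters. -/

section Circuits

variable {V : Type*}

theorem injOn_comp_perm {f : ℕ → V} {I : Finset ℕ} (hf : Set.InjOn f I) (σ : Equiv.Perm ℕ)
    (hσ : ∀ i ∈ I, σ i ∈ I) : Set.InjOn (f ∘ σ) I :=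
  fun _ hi _ hj h => σ.injective (hf (hσ _ hi) (hσ _ hj) h)

variable [DecidableEq V]

/-- One step inside `W` between triples with at least two common vertices. -/
def CircuitStep (C : Finset (Finset V)) (W T T' : Finset V) : Prop :=
  T' ∈ C ∧ T' ⊆ W ∧ (T ∪ T').card ≤ 4

theorem CircuitStep.mono {C : Finset (Finset V)} {W W' : Finset V} (h : W ⊆ W') {T T' : Finset V}
    (hT : Relation.ReflTransGen (CircuitStep C W) T T') :
    Relation.ReflTransGen (CircuitStep C W') T T' :=
  hT.lift id fun _ _ hs => ⟨hs.1, hs.2.1.trans h, hs.2.2⟩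

variable [Fintype V]

theorem mem_inducedSubclutter_complement {C : Finset (Finset V)} {W T : Finset V} :
    T ∈ inducedSubclutter (clutterComplement 3 C) W ↔ (T.card = 3 ∧ T ∉ C) ∧ T ⊆ W := by
  simp [inducedSubclutter, clutterComplement, Finset.mem_powersetCard]

theorem clutterIso_of_partition {C : Finset (Finset V)} {f : ℕ → V} {I : Finset ℕ}
    (hf : Set.InjOn f I) {A B : Finset (Finset ℕ)} (hAB : A ∪ B = I.powersetCard 3)
    (hA : ∀ G ∈ A, G.image f ∉ C) (hB : ∀ G ∈ B, G.image f ∈ C) :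
    ClutterIso A (inducedSubclutter (clutterComplement 3 C) (I.image f)) := by
  have hsub : ∀ G ∈ A ∪ B, G ⊆ I ∧ G.card = 3 := fun G hG => by
    rw [hAB] at hG
    exact Finset.mem_powersetCard.1 hG
  refine ⟨f, hf.mono ?_, ?_⟩
  · rw [Finset.coe_subset, Finset.sup_le_iff]
    exact fun G hG => (hsub G (Finset.mem_union_left _ hG)).1
  · ext T
    rw [mem_inducedSubclutter_complement, Finset.mem_image]
    constructor
    · rintro ⟨G, hG, rfl⟩
      obtain ⟨h1, h2⟩ := hsub G (Finset.mem_union_left _ hG)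
      refine ⟨⟨?_, hA G hG⟩, Finset.image_subset_image h1⟩
      rw [Finset.card_image_of_injOn (hf.mono (Finset.coe_subset.2 h1)), h2]
    · rintro ⟨⟨h1, h2⟩, h3⟩
      obtain ⟨G, hG, rfl⟩ := Finset.subset_image_iff.1 h3
      rw [Finset.card_image_of_injOn (hf.mono (Finset.coe_subset.2 hG))] at h1
      have hm : G ∈ A ∪ B := by
        rw [hAB]
        exact Finset.mem_powersetCard.2 ⟨hG, h1⟩
      rcases Finset.mem_union.1 hm with hm | hm
      · exact ⟨G, hm, rfl⟩
      · exact absurd (hB G hm) h2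

/-- Only `125` and `135` are undetermined among the ten triples. The four cases give `bipyramid`,
`bipyramidOne` (twice, up to swapping `2` and `3`) and `bipyramidTwo`. -/
theorem not_free_of_bipyramid {C : Finset (Finset V)} {f : ℕ → V}
    (hf : Set.InjOn f (Finset.Icc 1 5 : Finset ℕ)) (hA : ∀ G ∈ bipyramid, G.image f ∉ C)
    (h234 : ({2, 3, 4} : Finset ℕ).image f ∈ C) (h145 : ({1, 4, 5} : Finset ℕ).image f ∈ C) :
    ¬ IsFamilyFree forbiddenFamily (clutterComplement 3 C) := by
  intro hfree
  have hone : ∀ g : ℕ → V, Set.InjOn g (Finset.Icc 1 5 : Finset ℕ) →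
      (∀ G ∈ bipyramidOne, G.image g ∉ C) →
      (∀ G ∈ ({{1, 3, 5}, {2, 3, 4}, {1, 4, 5}} : Finset (Finset ℕ)), G.image g ∈ C) → False :=
    fun g hg h1 h2 => hfree bipyramidOne (by simp [forbiddenFamily]) _
      (clutterIso_of_partition hg (by decide) h1 h2)
  by_cases h125 : ({1, 2, 5} : Finset ℕ).image f ∈ C <;>
    by_cases h135 : ({1, 3, 5} : Finset ℕ).image f ∈ C
  · refine hfree bipyramid (by simp [forbiddenFamily]) _
      (clutterIso_of_partition hf (B := {{1, 2, 5}, {1, 3, 5}, {2, 3, 4}, {1, 4, 5}})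
        (by decide) hA ?_)
    simp only [Finset.mem_insert, Finset.mem_singleton]
    rintro G (rfl | rfl | rfl | rfl) <;> assumption
  · let σ : Equiv.Perm ℕ := Equiv.swap 2 3
    refine hone (f ∘ σ) (injOn_comp_perm hf σ (by decide)) (fun G hG => ?_) (fun G hG => ?_)
    · rw [← Finset.image_image]
      have h1 : ∀ G ∈ bipyramidOne, G.image σ ∈ bipyramid ∪ {{1, 3, 5}} := by decide
      rcases Finset.mem_union.1 (h1 G hG) with h | h
      · exact hA _ h
      · rw [Finset.mem_singleton.1 h]
        exact h135
    · rw [← Finset.image_image]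
      have h1 : ∀ G ∈ ({{1, 3, 5}, {2, 3, 4}, {1, 4, 5}} : Finset (Finset ℕ)),
          G.image σ = {1, 2, 5} ∨ G.image σ = {2, 3, 4} ∨ G.image σ = {1, 4, 5} := by decide
      rcases h1 G hG with h | h | h <;> rw [h] <;> assumption
  · refine hone f hf (fun G hG => ?_) ?_
    · rcases Finset.mem_union.1 hG with h | h
      · exact hA _ h
      · rw [Finset.mem_singleton.1 h]
        exact h125
    · simp only [Finset.mem_insert, Finset.mem_singleton]
      rintro G (rfl | rfl | rfl) <;> assumption
  · refine hfree bipyramidTwo (by simp [forbiddenFamily]) _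
      (clutterIso_of_partition hf (B := {{2, 3, 4}, {1, 4, 5}}) (by decide) (fun G hG => ?_) ?_)
    · rcases Finset.mem_union.1 hG with h | h
      · exact hA _ h
      · simp only [Finset.mem_insert, Finset.mem_singleton] at h
        rcases h with rfl | rfl <;> assumption
    · simp only [Finset.mem_insert, Finset.mem_singleton]
      rintro G (rfl | rfl) <;> assumption

theorem reflTransGen_circuitStep_five {C : Finset (Finset V)} {f : ℕ → V}
    (hfree : IsFamilyFree forbiddenFamily (clutterComplement 3 C))
    (hf : Set.InjOn f (Finset.Icc 1 5 : Finset ℕ))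
    (h234 : ({2, 3, 4} : Finset ℕ).image f ∈ C) (h145 : ({1, 4, 5} : Finset ℕ).image f ∈ C) :
    Relation.ReflTransGen (CircuitStep C ((Finset.Icc 1 5).image f))
      (({2, 3, 4} : Finset ℕ).image f) (({1, 4, 5} : Finset ℕ).image f) := by
  by_contra hno
  have hstep : ∀ G G' : Finset ℕ, G'.image f ∈ C → G' ⊆ Finset.Icc 1 5 → (G ∪ G').card ≤ 4 →
      CircuitStep C ((Finset.Icc 1 5).image f) (G.image f) (G'.image f) :=
    fun G G' h1 h2 h3 => ⟨h1, Finset.image_subset_image h2, by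
      rw [← Finset.image_union]
      exact Finset.card_image_le.trans h3⟩
  -- Each of these triples shares two vertices with both ends.
  have hcross : ∀ G ∈ ({{1, 2, 4}, {2, 4, 5}, {1, 3, 4}, {3, 4, 5}} : Finset (Finset ℕ)),
      G.image f ∉ C := by
    intro G hG hGC
    have h1 : ∀ G ∈ ({{1, 2, 4}, {2, 4, 5}, {1, 3, 4}, {3, 4, 5}} : Finset (Finset ℕ)),
        G ⊆ Finset.Icc 1 5 ∧ ({2, 3, 4} ∪ G).card ≤ 4 ∧ (G ∪ {1, 4, 5}).card ≤ 4 := by decide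
    obtain ⟨h2, h3, h4⟩ := h1 G hG
    exact hno ((Relation.ReflTransGen.single (hstep _ G hGC h2 h3)).tail
      (hstep G _ h145 (by decide) h4))
  -- `123`, `235` neighbour `234`; `125`, `135` neighbour `145`; and each of the first pair
  -- neighbours each of the second. So one pair contains no circuit, which leaves a bi-pyramid with
  -- apexes `1`, `5` or, relabelled by `σ`, with apexes `2`, `3`.
  by_cases h1 : ∀ G ∈ ({{1, 2, 3}, {2, 3, 5}} : Finset (Finset ℕ)), G.image f ∉ C
  · refine not_free_of_bipyramid hf (fun G hG => ?_) h234 h145 hfree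
    have h2 : bipyramid = ({{1, 2, 4}, {2, 4, 5}, {1, 3, 4}, {3, 4, 5}} : Finset (Finset ℕ)) ∪
      {{1, 2, 3}, {2, 3, 5}} := by decide
    rw [h2] at hG
    rcases Finset.mem_union.1 hG with h | h
    · exact hcross G h
    · exact h1 G h
  by_cases h2 : ∀ G ∈ ({{1, 2, 5}, {1, 3, 5}} : Finset (Finset ℕ)), G.image f ∉ C
  · let σ : Equiv.Perm ℕ := Equiv.swap 1 2 * Equiv.swap 3 5
    refine not_free_of_bipyramid (f := f ∘ σ) (injOn_comp_perm hf σ (by decide)) (fun G hG => ?_)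
      ?_ ?_ hfree
    · rw [← Finset.image_image]
      have h3 : ∀ G ∈ bipyramid, G.image σ ∈
        ({{1, 2, 4}, {2, 4, 5}, {1, 3, 4}, {3, 4, 5}} : Finset (Finset ℕ)) ∪
        {{1, 2, 5}, {1, 3, 5}} := by decide
      rcases Finset.mem_union.1 (h3 G hG) with h | h
      · exact hcross _ h
      · exact h2 _ h
    · rw [← Finset.image_image, show ({2, 3, 4} : Finset ℕ).image σ = {1, 4, 5} by decide]
      exact h145
    · rw [← Finset.image_image, show ({1, 4, 5} : Finset ℕ).image σ = {2, 3, 4} by decide]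
      exact h234
  push Not at h1 h2
  obtain ⟨G, hG, hGC⟩ := h1
  obtain ⟨G', hG', hGC'⟩ := h2
  have h3 : ∀ G ∈ ({{1, 2, 3}, {2, 3, 5}} : Finset (Finset ℕ)),
      ∀ G' ∈ ({{1, 2, 5}, {1, 3, 5}} : Finset (Finset ℕ)),
      G ⊆ Finset.Icc 1 5 ∧ G' ⊆ Finset.Icc 1 5 ∧ ({2, 3, 4} ∪ G).card ≤ 4 ∧
        (G ∪ G').card ≤ 4 ∧ (G' ∪ {1, 4, 5}).card ≤ 4 := by decide
  obtain ⟨s1, s2, s3, s4, s5⟩ := h3 G hG G' hG'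
  exact hno (((Relation.ReflTransGen.single (hstep _ G hGC s1 s3)).tail
    (hstep G G' hGC' s2 s4)).tail (hstep G' _ h145 (by decide) s5))

theorem reflTransGen_circuitStep_of_card_inter {C : Finset (Finset V)} (hC3 : IsUniform 3 C)
    (hfree : IsFamilyFree forbiddenFamily (clutterComplement 3 C))
    {T T' : Finset V} (hT : T ∈ C) (hT' : T' ∈ C) (h : (T ∩ T').card = 1) :
    Relation.ReflTransGen (CircuitStep C (T ∪ T')) T T' := by
  have h1 : (T \ T').card = 2 := by
    have := Finset.card_sdiff_add_card_inter T T'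
    have := hC3 T hT
    omega
  have h2 : (T' \ T).card = 2 := by
    have := Finset.card_sdiff_add_card_inter T' T
    rw [Finset.inter_comm] at this
    have := hC3 T' hT'
    omega
  obtain ⟨x, hx⟩ := Finset.card_eq_one.1 h
  obtain ⟨a, b, hab, h1⟩ := Finset.card_eq_two.1 h1
  obtain ⟨c, d, hcd, h2⟩ := Finset.card_eq_two.1 h2
  have mx : x ∈ T ∩ T' := by simp [hx]
  have ma : a ∈ T \ T' := by simp [h1]
  have mb : b ∈ T \ T' := by simp [h1]
  have mc : c ∈ T' \ T := by simp [h2]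
  have md : d ∈ T' \ T := by simp [h2]
  have eT : T = {a, b, x} := by
    rw [← Finset.sdiff_union_inter T T', h1, hx]
    ext; simp
  have eT' : T' = {c, x, d} := by
    rw [← Finset.sdiff_union_inter T' T, h2, Finset.inter_comm, hx]
    ext; simp; tauto
  simp only [Finset.mem_inter, Finset.mem_sdiff] at mx ma mb mc md
  let f : ℕ → V := fun n =>
    if n = 1 then c else if n = 2 then a else if n = 3 then b else if n = 4 then x else d
  have hac : a ≠ c := by rintro rfl; tauto
  have had : a ≠ d := by rintro rfl; tauto
  have hax : a ≠ x := by rintro rfl; tauto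
  have hbc : b ≠ c := by rintro rfl; tauto
  have hbd : b ≠ d := by rintro rfl; tauto
  have hbx : b ≠ x := by rintro rfl; tauto
  have hcx : c ≠ x := by rintro rfl; tauto
  have hdx : d ≠ x := by rintro rfl; tauto
  have hf : Set.InjOn f (Finset.Icc 1 5 : Finset ℕ) := by
    intro i hi j hj hij
    simp only [Finset.coe_Icc, Set.mem_Icc] at hi hj
    obtain ⟨hi1, hi2⟩ := hi
    obtain ⟨hj1, hj2⟩ := hj
    interval_cases i <;> interval_cases j <;> first
      | rfl
      | (simp only [f] at hij
         norm_num at hij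
         first
         | exact absurd hij (by assumption)
         | exact absurd hij.symm (by assumption))
  have e1 : ({2, 3, 4} : Finset ℕ).image f = T := by
    rw [eT]; simp [f, Finset.image_insert]
  have e2 : ({1, 4, 5} : Finset ℕ).image f = T' := by
    rw [eT']; simp [f, Finset.image_insert]
  have e3 : (Finset.Icc 1 5).image f = T ∪ T' := by
    rw [← e1, ← e2, ← Finset.image_union]
    exact congrArg _ (by decide)
  have := reflTransGen_circuitStep_five hfree hf (e1 ▸ hT) (e2 ▸ hT')
  rwa [e1, e2, e3] at this

theorem not_free_of_six {C : Finset (Finset V)} (hC3 : IsUniform 3 C) {T T' : Finset V}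
    (hT : T ∈ C) (hT' : T' ∈ C) (h : Disjoint T T')
    (honly : ∀ G ∈ C, G ⊆ T ∪ T' → G = T ∨ G = T') :
    ¬ IsFamilyFree forbiddenFamily (clutterComplement 3 C) := by
  intro hfree
  obtain ⟨a, b, c, hab, hac, hbc, eT⟩ := Finset.card_eq_three.1 (hC3 T hT)
  obtain ⟨d, e, g, hde, hdg, heg, eT'⟩ := Finset.card_eq_three.1 (hC3 T' hT')
  have hne : ∀ u ∈ T, ∀ v ∈ T', u ≠ v := Finset.disjoint_iff_ne.1 h
  let f : ℕ → V := fun n => if n = 1 then a else if n = 2 then b else if n = 3 then c else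
    if n = 4 then d else if n = 5 then e else g
  have hf : Set.InjOn f (Finset.Icc 1 6 : Finset ℕ) := by
    simp only [eT, eT', Finset.mem_insert, Finset.mem_singleton, forall_eq_or_imp, forall_eq]
      at hne
    obtain ⟨⟨_, _, _⟩, ⟨_, _, _⟩, _, _, _⟩ := hne
    intro i hi j hj hij
    simp only [Finset.coe_Icc, Set.mem_Icc] at hi hj
    obtain ⟨hi1, hi2⟩ := hi
    obtain ⟨hj1, hj2⟩ := hj
    interval_cases i <;> interval_cases j <;> first
      | rfl
      | (simp only [f] at hij
         norm_num at hij
         first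
         | exact absurd hij (by assumption)
         | exact absurd hij.symm (by assumption))
  have e1 : ({1, 2, 3} : Finset ℕ).image f = T := by
    rw [eT]; simp [f, Finset.image_insert]
  have e2 : ({4, 5, 6} : Finset ℕ).image f = T' := by
    rw [eT']; simp [f, Finset.image_insert]
  have e3 : (Finset.Icc 1 6).image f = T ∪ T' := by
    rw [← e1, ← e2, ← Finset.image_union]
    exact congrArg _ (by decide)
  refine hfree sixPointClutter (by simp [forbiddenFamily]) _
    (clutterIso_of_partition hf (B := {{1, 2, 3}, {4, 5, 6}}) ?_ (fun G hG hGC => ?_) ?_)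
  · exact Finset.sdiff_union_of_subset (by decide)
  · obtain ⟨hG1, hG2⟩ := Finset.mem_sdiff.1 hG
    have hGI := (Finset.mem_powersetCard.1 hG1).1
    have hinj : ∀ H : Finset ℕ, H ⊆ Finset.Icc 1 6 → G.image f = H.image f → G = H := by
      intro H hH he
      have h3 := congrArg (fun s : Finset V => (s : Set V)) he
      simp only [Finset.coe_image] at h3
      exact Finset.coe_injective
        ((hf.image_eq_image_iff (Finset.coe_subset.2 hGI) (Finset.coe_subset.2 hH)).1 h3)
    apply hG2
    simp only [Finset.mem_insert, Finset.mem_singleton]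
    rcases honly _ hGC (e3 ▸ Finset.image_subset_image hGI) with h3 | h3
    · exact Or.inl (hinj _ (by decide) (h3.trans e1.symm))
    · exact Or.inr (hinj _ (by decide) (h3.trans e2.symm))
  · simp only [Finset.mem_insert, Finset.mem_singleton]
    rintro G (rfl | rfl)
    · rwa [e1]
    · rwa [e2]

/-- For disjoint ends, a third circuit in the union lies in neither end, so it meets both, and the
intersecting case applies twice. -/
theorem reflTransGen_circuitStep {C : Finset (Finset V)} (hC3 : IsUniform 3 C)
    (hfree : IsFamilyFree forbiddenFamily (clutterComplement 3 C))
    {T T' : Finset V} (hT : T ∈ C) (hT' : T' ∈ C) :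
    Relation.ReflTransGen (CircuitStep C (T ∪ T')) T T' := by
  have close : ∀ {A B : Finset V}, A ∈ C → B ∈ C → A ∩ B ≠ ∅ →
      Relation.ReflTransGen (CircuitStep C (A ∪ B)) A B := by
    intro A B hA hB hne
    by_cases h1 : (A ∩ B).card = 1
    · exact reflTransGen_circuitStep_of_card_inter hC3 hfree hA hB h1
    · refine Relation.ReflTransGen.single ⟨hB, Finset.subset_union_right, ?_⟩
      have h2 := Finset.card_union_add_card_inter A B
      have h3 := Finset.card_pos.2 (Finset.nonempty_iff_ne_empty.2 hne)
      rw [hC3 A hA, hC3 B hB] at h2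
      omega
  by_cases hdisj : T ∩ T' = ∅
  · have hD := Finset.disjoint_iff_inter_eq_empty.2 hdisj
    have hex : ¬ ∀ G ∈ C, G ⊆ T ∪ T' → G = T ∨ G = T' :=
      fun h => not_free_of_six hC3 hT hT' hD h hfree
    push Not at hex
    obtain ⟨G, hG, hGW, hGT, hGT'⟩ := hex
    have notsub : ∀ {A : Finset V}, A ∈ C → G ≠ A → ¬ G ⊆ A := fun hA hne hs =>
      hne (Finset.eq_of_subset_of_card_le hs (by rw [hC3 _ hA, hC3 _ hG]))
    have h1 : T ∩ G ≠ ∅ := by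
      intro h
      refine notsub hT' hGT' fun x hx => ?_
      rcases Finset.mem_union.1 (hGW hx) with h2 | h2
      · exact absurd (Finset.mem_inter.2 ⟨h2, hx⟩) (by simp [h])
      · exact h2
    have h2 : G ∩ T' ≠ ∅ := by
      intro h
      refine notsub hT hGT fun x hx => ?_
      rcases Finset.mem_union.1 (hGW hx) with h2 | h2
      · exact h2
      · exact absurd (Finset.mem_inter.2 ⟨hx, h2⟩) (by simp [h])
    exact (CircuitStep.mono (Finset.union_subset Finset.subset_union_left hGW)
      (close hT hG h1)).trans (CircuitStep.mono (Finset.union_subset hGW Finset.subset_union_right)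
      (close hG hT' h2))
  · exact close hT hT' hdisj

/-- The triples of `I` missing from `D` become exactly the circuits of `C` inside `U = I.image f`.
The set `W` itself may be larger, with vertices in no triple of the induced complement. -/
theorem exists_twins_of_clutterIso {C : Finset (Finset V)} (hC3 : IsUniform 3 C)
    {D : Finset (Finset ℕ)} {W : Finset V}
    (hiso : ClutterIso D (inducedSubclutter (clutterComplement 3 C) W))
    {I : Finset ℕ} (hI : D.sup id = I) {i j : ℕ} (hi : i ∈ I) (hj : j ∈ I) (hij : i ≠ j)
    (htwin : ∀ G ∈ I.powersetCard 3 \ D, i ∈ G ↔ j ∈ G) {G₁ G₂ : Finset ℕ}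
    (hG₁ : G₁ ∈ I.powersetCard 3 \ D) (hG₂ : G₂ ∈ I.powersetCard 3 \ D)
    (h₁ : i ∈ G₁) (h₂ : i ∉ G₂) :
    ∃ (p q : V) (U : Finset V), p ≠ q ∧ (∀ T ∈ C, T ⊆ U → (p ∈ T ↔ q ∈ T)) ∧
      ∃ T₁ ∈ C, ∃ T₂ ∈ C, T₁ ⊆ U ∧ T₂ ⊆ U ∧ p ∈ T₁ ∧ p ∉ T₂ := by
  obtain ⟨f, hf, himg⟩ := hiso
  rw [hI] at hf
  have hmem : ∀ G ⊆ I, ∀ k ∈ I, f k ∈ G.image f ↔ k ∈ G := fun G hG k hk => by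
    rw [Finset.mem_image]
    constructor
    · rintro ⟨l, hl, he⟩
      rwa [← hf (hG hl) hk he]
    · exact fun h => ⟨k, h, rfl⟩
  have hIW : I.image f ⊆ W := by
    intro x hx
    obtain ⟨k, hk, rfl⟩ := Finset.mem_image.1 hx
    rw [← hI, Finset.mem_sup] at hk
    obtain ⟨G, hG, hk⟩ := hk
    have h1 : G.image f ∈ inducedSubclutter (clutterComplement 3 C) W := by
      rw [← himg]
      exact Finset.mem_image_of_mem _ hG
    exact (mem_inducedSubclutter_complement.1 h1).2 (Finset.mem_image_of_mem f hk)
  have hDI : ∀ G ∈ D, G ⊆ I := fun G hG => hI ▸ Finset.le_sup (f := id) hG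
  have hnotC : ∀ G ∈ D, G.image f ∉ C := fun G hG => by
    have h1 : G.image f ∈ inducedSubclutter (clutterComplement 3 C) W := by
      rw [← himg]
      exact Finset.mem_image_of_mem _ hG
    exact (mem_inducedSubclutter_complement.1 h1).1.2
  have hinC : ∀ G ∈ I.powersetCard 3 \ D, G.image f ∈ C := by
    intro G hG
    obtain ⟨h1, h2⟩ := Finset.mem_sdiff.1 hG
    obtain ⟨hGI, hcard⟩ := Finset.mem_powersetCard.1 h1
    by_contra hno
    have h3 : G.image f ∈ inducedSubclutter (clutterComplement 3 C) W :=
      mem_inducedSubclutter_complement.2 ⟨⟨by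
        rw [Finset.card_image_of_injOn (hf.mono (Finset.coe_subset.2 hGI)), hcard], hno⟩,
        (Finset.image_subset_image hGI).trans hIW⟩
    rw [← himg] at h3
    obtain ⟨G', hG', he⟩ := Finset.mem_image.1 h3
    have h4 : G' = G := by
      have h5 := congrArg (fun s : Finset V => (s : Set V)) he
      simp only [Finset.coe_image] at h5
      exact Finset.coe_injective ((hf.image_eq_image_iff (Finset.coe_subset.2 (hDI _ hG'))
        (Finset.coe_subset.2 hGI)).1 h5)
    exact h2 (h4 ▸ hG')
  refine ⟨f i, f j, I.image f, fun h => hij (hf hi hj h), fun T hT hTU => ?_,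
    _, hinC _ hG₁, _, hinC _ hG₂, ?_, ?_, ?_, ?_⟩
  · obtain ⟨G, hG, rfl⟩ := Finset.subset_image_iff.1 hTU
    rw [hmem G hG i hi, hmem G hG j hj]
    refine htwin G (Finset.mem_sdiff.2 ⟨Finset.mem_powersetCard.2 ⟨hG, ?_⟩,
      fun h => hnotC G h hT⟩)
    rw [← hC3 _ hT, Finset.card_image_of_injOn (hf.mono (Finset.coe_subset.2 hG))]
  · exact Finset.image_subset_image (Finset.mem_powersetCard.1 (Finset.mem_sdiff.1 hG₁).1).1
  · exact Finset.image_subset_image (Finset.mem_powersetCard.1 (Finset.mem_sdiff.1 hG₂).1).1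
  · exact Finset.mem_image_of_mem f h₁
  · rwa [hmem G₂ (Finset.mem_powersetCard.1 (Finset.mem_sdiff.1 hG₂).1).1 i hi]

set_option maxRecDepth 10000 in
theorem exists_twins_of_not_free {C : Finset (Finset V)} (hC3 : IsUniform 3 C)
    (hfree : ¬ IsFamilyFree forbiddenFamily (clutterComplement 3 C)) :
    ∃ (p q : V) (U : Finset V), p ≠ q ∧ (∀ T ∈ C, T ⊆ U → (p ∈ T ↔ q ∈ T)) ∧
      ∃ T₁ ∈ C, ∃ T₂ ∈ C, T₁ ⊆ U ∧ T₂ ⊆ U ∧ p ∈ T₁ ∧ p ∉ T₂ := by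
  unfold IsFamilyFree at hfree
  push Not at hfree
  obtain ⟨D, hD, W, hiso⟩ := hfree
  simp only [forbiddenFamily, Set.mem_insert_iff, Set.mem_singleton_iff] at hD
  -- In the bi-pyramid types the missing triples other than `234` all contain both apexes `1`, `5`;
  -- in the last type only `123` and `456` are missing, so `1`, `2` are twins.
  rcases hD with rfl | rfl | rfl | rfl
  · exact exists_twins_of_clutterIso hC3 hiso (I := Finset.Icc 1 5) (i := 1) (j := 5)
      (G₁ := {1, 4, 5}) (G₂ := {2, 3, 4}) (by decide) (by decide) (by decide) (by decide)
      (by decide) (by decide) (by decide) (by decide) (by decide)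
  · exact exists_twins_of_clutterIso hC3 hiso (I := Finset.Icc 1 5) (i := 1) (j := 5)
      (G₁ := {1, 4, 5}) (G₂ := {2, 3, 4}) (by decide) (by decide) (by decide) (by decide)
      (by decide) (by decide) (by decide) (by decide) (by decide)
  · exact exists_twins_of_clutterIso hC3 hiso (I := Finset.Icc 1 5) (i := 1) (j := 5)
      (G₁ := {1, 4, 5}) (G₂ := {2, 3, 4}) (by decide) (by decide) (by decide) (by decide)
      (by decide) (by decide) (by decide) (by decide) (by decide)
  · exact exists_twins_of_clutterIso hC3 hiso (I := Finset.Icc 1 6) (i := 1) (j := 2)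
      (G₁ := {1, 2, 3}) (G₂ := {4, 5, 6}) (by decide) (by decide) (by decide) (by decide)
      (by decide) (by decide) (by decide) (by decide) (by decide)

end Circuits

/-! ### Powers of the edge ideal, their exponents and Betti numbers. -/

section EdgeIdeals

variable {K : Type*} [Field K] {V : Type*}

/-- The exponent of the square-free monomial with support `T`. -/
noncomputable def indicatorExponent (T : Finset V) : V →₀ ℕ :=
  ∑ v ∈ T, Finsupp.single v 1

theorem indicatorExponent_apply [DecidableEq V] (T : Finset V) (x : V) :
    indicatorExponent T x = if x ∈ T then 1 else 0 := by
  simp [indicatorExponent, Finsupp.finsetSum_apply, Finsupp.single_apply]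

theorem degree_indicatorExponent (T : Finset V) : (indicatorExponent T).degree = T.card := by
  simp [indicatorExponent, map_sum]

theorem indicatorExponent_sup [DecidableEq V] (S T : Finset V) :
    indicatorExponent S ⊔ indicatorExponent T = indicatorExponent (S ∪ T) := by
  ext x
  simp only [Finsupp.sup_apply, indicatorExponent_apply, Finset.mem_union]
  by_cases h1 : x ∈ S <;> by_cases h2 : x ∈ T <;> simp [h1, h2]

theorem indicatorExponent_mono {S T : Finset V} (h : S ⊆ T) :
    indicatorExponent S ≤ indicatorExponent T := by
  classical
  intro x
  simp only [indicatorExponent_apply]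
  by_cases h1 : x ∈ S
  · simp [h1, h h1]
  · simp [h1]

/-- The exponents of the generators of the edge ideal. -/
def edgeExponents (C : Finset (Finset V)) : Set (V →₀ ℕ) :=
  indicatorExponent '' (C : Set (Finset V))

/-- Sums of `k` elements of a set of exponents. -/
def iteratedSumset (A : Set (V →₀ ℕ)) : ℕ → Set (V →₀ ℕ)
  | 0 => {0}
  | k + 1 => {w | ∃ u ∈ iteratedSumset A k, ∃ v ∈ A, u + v = w}

theorem edgeIdeal_eq_monomialIdeal (C : Finset (Finset V)) :
    edgeIdeal K C = monomialIdeal K (edgeExponents C) := by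
  unfold edgeIdeal monomialIdeal edgeExponents
  congr 1
  have hprod : ∀ T : Finset V, monomial (indicatorExponent T) (1 : K) = ∏ v ∈ T, X v :=
    fun T => monomial_sum_one T _
  ext f
  simp only [Set.mem_ofPred_eq, Set.mem_image, Finset.mem_coe, exists_exists_and_eq_and, hprod]
  exact exists_congr fun T => and_congr_right fun _ => eq_comm

theorem monomialIdeal_pow (A : Set (V →₀ ℕ)) (k : ℕ) :
    monomialIdeal K A ^ k = monomialIdeal K (iteratedSumset A k) := by
  induction k with
  | zero =>
    rw [pow_zero, Ideal.one_eq_top, eq_comm, Ideal.eq_top_iff_one]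
    exact Ideal.subset_span ⟨0, rfl, rfl⟩
  | succ k ih =>
    rw [pow_succ, ih]
    unfold monomialIdeal
    rw [Ideal.span_mul_span']
    congr 1
    ext f
    constructor
    · rintro ⟨_, ⟨u, hu, rfl⟩, _, ⟨v, hv, rfl⟩, rfl⟩
      exact ⟨u + v, ⟨u, hu, v, hv, rfl⟩, by simp [monomial_mul]⟩
    · rintro ⟨_, ⟨u, hu, v, hv, rfl⟩, rfl⟩
      exact ⟨_, ⟨u, hu, rfl⟩, _, ⟨v, hv, rfl⟩, by simp [monomial_mul]⟩

theorem degree_of_mem_iteratedSumset {A : Set (V →₀ ℕ)} {d : ℕ} (hA : ∀ u ∈ A, u.degree = d)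
    {k : ℕ} : ∀ w ∈ iteratedSumset A k, w.degree = d * k := by
  induction k with
  | zero => rintro w rfl; simp
  | succ k ih =>
    rintro _ ⟨u, hu, v, hv, rfl⟩
    rw [map_add, ih u hu, hA v hv, mul_add, mul_one]

theorem nsmul_mem_iteratedSumset {A : Set (V →₀ ℕ)} {u : V →₀ ℕ} (hu : u ∈ A) (k : ℕ) :
    k • u ∈ iteratedSumset A k := by
  induction k with
  | zero => exact zero_smul _ _
  | succ k ih => exact ⟨_, ih, u, hu, (succ_nsmul u k).symm⟩

theorem degree_of_mem_edgeExponents {C : Finset (Finset V)} {d : ℕ} (hC : IsUniform d C) :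
    ∀ u ∈ edgeExponents C, u.degree = d := by
  rintro _ ⟨T, hT, rfl⟩
  rw [degree_indicatorExponent, hC T hT]

theorem apply_eq_apply_of_mem_iteratedSumset {C : Finset (Finset V)} {p q : V} {U : Finset V}
    (htwin : ∀ T ∈ C, T ⊆ U → (p ∈ T ↔ q ∈ T)) {k : ℕ} :
    ∀ w ∈ iteratedSumset (edgeExponents C) k, (∀ x ∉ U, w x = 0) → w p = w q := by
  classical
  induction k with
  | zero => rintro w rfl _; rfl
  | succ k ih =>
    rintro _ ⟨u, hu, _, ⟨T, hT, rfl⟩, rfl⟩ hx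
    have hx' : ∀ x ∉ U, u x = 0 ∧ indicatorExponent T x = 0 := fun x hxU => by
      have := hx x hxU
      rw [Finsupp.add_apply] at this
      omega
    have hTU : T ⊆ U := by
      intro x hxT
      by_contra hxU
      have := (hx' x hxU).2
      simp [indicatorExponent_apply, hxT] at this
    rw [Finsupp.add_apply, Finsupp.add_apply, ih u hu fun x hxU => (hx' x hxU).1,
      indicatorExponent_apply, indicatorExponent_apply]
    simp only [htwin T hT hTU]

/-- If the exponent grew at `p` it would grow at `q` too, forcing the lcm to have degree at least `d
+ 2`. -/
theorem apply_eq_of_degree_sup_le {w w' : V →₀ ℕ} {d : ℕ} (hw : w.degree = d)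
    (hw' : w'.degree = d) (hs : (w ⊔ w').degree ≤ d + 1) {p q : V} (hpq : p ≠ q)
    (h : w p = w q) (h' : w' p = w' q) : w p = w' p := by
  have key : ∀ {w w' : V →₀ ℕ}, w.degree = d → (w ⊔ w').degree ≤ d + 1 → w p = w q →
      w' p = w' q → w' p ≤ w p := by
    classical
    intro w w' hw hs h h'
    by_contra! hlt
    have hle : w + Finsupp.single p 1 + Finsupp.single q 1 ≤ w ⊔ w' := by
      intro x
      simp only [Finsupp.add_apply, Finsupp.sup_apply, Finsupp.single_apply]
      by_cases hp : p = x
      · subst hp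
        simp only [if_true, if_neg hpq.symm]
        exact le_sup_of_le_right (by omega)
      · by_cases hq : q = x
        · subst hq
          simp only [if_true, if_neg hp]
          exact le_sup_of_le_right (by omega)
        · simp [hp, hq]
    have := Finsupp.degree_mono hle
    simp only [map_add, Finsupp.degree_single] at this
    omega
  exact le_antisymm (key hw' (sup_comm w w' ▸ hs) h' h) (key hw hs h h')

theorem degree_le_of_mem_span {G : Set (MvPolynomial V K)} {d : ℕ}
    (hG : ∀ f ∈ G, f.IsHomogeneous d) {f : MvPolynomial V K} (hf : f ∈ Ideal.span G) :
    ∀ m ∈ f.support, d ≤ m.degree := by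
  classical
  induction hf using Submodule.span_induction with
  | mem f hf =>
    intro m hm
    have := hG f hf (mem_support_iff.1 hm)
    rw [Finsupp.degree_eq_weight_one]
    exact this.ge
  | zero => simp
  | add f g _ _ ihf ihg =>
    intro m hm
    rcases Finset.mem_union.1 (support_add hm) with h | h
    · exact ihf m h
    · exact ihg m h
  | smul r f _ ih =>
    intro m hm
    obtain ⟨a, -, b, hb, rfl⟩ := Finset.mem_add.1 (support_mul r f hm)
    rw [map_add]
    exact (ih b hb).trans (Nat.le_add_left _ _)

variable [Fintype V] [DecidableEq V]

/-- `F` is the very resolution chosen in the definition of `multigradedBetti`, which avoids any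
appeal to uniqueness. -/
theorem exists_resolution_gradedBetti_ne_zero_iff (M : Set (V →₀ ℕ)) :
    ∃ F : MultigradedResolution (monomialIdeal K M), F.IsMinimal ∧
      ∀ i j, gradedBetti (monomialIdeal K M) i j ≠ 0 ↔ ∃ b, (F.deg i b).degree = j := by
  have hex := exists_minimal_multigradedResolution (K := K) M
  refine ⟨hex.choose, hex.choose_spec, fun i j => ?_⟩
  unfold gradedBetti multigradedBetti
  rw [Ne, Finset.sum_eq_zero_iff]
  push Not
  simp only [dif_pos hex, Finset.mem_finsuppAntidiag, Finset.subset_univ, and_true,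
    ← Finsupp.degree_eq_sum, Finset.card_ne_zero, Finset.filter_nonempty_iff, Finset.mem_univ,
    true_and]
  constructor
  · rintro ⟨a, ha, b, rfl⟩
    exact ⟨b, ha⟩
  · rintro ⟨b, hb⟩
    exact ⟨_, hb, b, rfl⟩

theorem isStepLinear_one_of_free {C : Finset (Finset V)} (hC3 : IsUniform 3 C)
    (hfree : IsFamilyFree forbiddenFamily (clutterComplement 3 C)) :
    IsStepLinear (edgeIdeal K C) 1 := by
  rw [edgeIdeal_eq_monomialIdeal]
  have hM := degree_of_mem_edgeExponents hC3
  refine ⟨3, ⟨_, ?_, rfl⟩, ?_⟩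
  · rintro _ ⟨u, hu, rfl⟩
    exact isHomogeneous_monomial _ (hM u hu)
  · obtain ⟨F, hF, hb⟩ := exists_resolution_gradedBetti_ne_zero_iff (K := K) (edgeExponents C)
    intro i hi j hj
    by_contra hne
    obtain ⟨b, rfl⟩ := (hb i j).1 hne
    interval_cases i
    · rw [hM _ (hF.deg_zero_mem b)] at hj
      omega
    · refine absurd (hF.degree_deg_one_le (d := 3) ?_ hM b) (by omega)
      rintro _ ⟨T, hT, rfl⟩ _ ⟨T', hT', rfl⟩
      refine (reflTransGen_circuitStep hC3 hfree hT hT').lift indicatorExponent ?_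
      rintro A B ⟨h1, h2, h3⟩
      refine ⟨⟨B, h1, rfl⟩, ?_, ?_⟩
      · rw [indicatorExponent_sup]
        exact indicatorExponent_mono h2
      · rw [indicatorExponent_sup, degree_indicatorExponent]
        exact h3

theorem exists_nonlinear_syzygy_of_not_free {C : Finset (Finset V)} (hC3 : IsUniform 3 C)
    (hfree : ¬ IsFamilyFree forbiddenFamily (clutterComplement 3 C)) {k : ℕ} (hk : 1 ≤ k) :
    ∃ j, 3 * k + 1 < j ∧ gradedBetti (edgeIdeal K C ^ k) 1 j ≠ 0 := by
  rw [edgeIdeal_eq_monomialIdeal, monomialIdeal_pow]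
  obtain ⟨p, q, U, hpq, htwin, T₁, hT₁, T₂, hT₂, hU₁, hU₂, hp₁, hp₂⟩ :=
    exists_twins_of_not_free hC3 hfree
  set M := iteratedSumset (edgeExponents C) k with hMdef
  have hM : ∀ u ∈ M, u.degree = 3 * k :=
    degree_of_mem_iteratedSumset (degree_of_mem_edgeExponents hC3)
  obtain ⟨F, hF, hb⟩ := exists_resolution_gradedBetti_ne_zero_iff (K := K) M
  by_contra! hno
  have hdeg : ∀ b, (F.deg 1 b).degree ≤ 3 * k + 1 := fun b => by
    by_contra! hlt
    exact (hb 1 _).2 ⟨b, rfl⟩ (hno _ hlt)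
  set u := k • indicatorExponent T₁ with hu
  set v := k • indicatorExponent T₂ with hv
  have huM : u ∈ M := nsmul_mem_iteratedSumset (A := edgeExponents C) ⟨T₁, hT₁, rfl⟩ k
  have hvM : v ∈ M := nsmul_mem_iteratedSumset (A := edgeExponents C) ⟨T₂, hT₂, rfl⟩ k
  -- Support in `U` forces every factor of such a generator to be a circuit inside `U`, where the
  -- twin property holds.
  have hout : ∀ w ≤ u ⊔ v, ∀ x ∉ U, w x = 0 := by
    intro w hw x hx
    have h1 := hw x
    rw [Finsupp.sup_apply, hu, hv, Finsupp.smul_apply, Finsupp.smul_apply,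
      indicatorExponent_apply, indicatorExponent_apply, if_neg fun h => hx (hU₁ h),
      if_neg fun h => hx (hU₂ h)] at h1
    simpa using h1
  have heq : ∀ w ∈ M, w ≤ u ⊔ v → w p = w q := fun w hw hle =>
    apply_eq_apply_of_mem_iteratedSumset htwin w hw (hout w hle)
  have hinv : ∀ w, Relation.ReflTransGen (LinearStep M (3 * k) (u ⊔ v)) u w →
      w ∈ M ∧ w ≤ u ⊔ v ∧ u p = w p := by
    intro w hw
    induction hw with
    | refl => exact ⟨huM, le_sup_left, rfl⟩
    | tail _ hs ih =>
      obtain ⟨h1, h2, h3⟩ := ih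
      obtain ⟨s1, s2, s3⟩ := hs
      exact ⟨s1, s2, h3.trans (apply_eq_of_degree_sup_le (hM _ h1) (hM _ s1) s3 hpq
        (heq _ h1 h2) (heq _ s1 s2))⟩
  have hend := (hinv v (hF.reflTransGen_linearStep hM hdeg huM hvM)).2.2
  rw [hu, hv, Finsupp.smul_apply, Finsupp.smul_apply, indicatorExponent_apply,
    indicatorExponent_apply, if_pos hp₁, if_neg hp₂] at hend
  simp only [smul_eq_mul, mul_one, mul_zero] at hend
  omega

end EdgeIdeals

/-! ### The main theorem. -/

theorem proposition2p5 {K : Type*} [Field K] {V : Type*} [Fintype V] [DecidableEq V]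
    (C : Finset (Finset V)) (hC : IsClutter C) (hC3 : IsUniform 3 C) :
    (IsFamilyFree forbiddenFamily (clutterComplement 3 C) ↔
      ∃ k : ℕ, 1 ≤ k ∧ 1 < greenLazarsfeldIndex (edgeIdeal K C ^ k)) ∧
    (¬ IsFamilyFree forbiddenFamily (clutterComplement 3 C) →
      ∀ k : ℕ, 1 ≤ k → ∃ j : ℕ, 3 * k + 1 < j ∧ gradedBetti (edgeIdeal K C ^ k) 1 j ≠ 0) := by
  refine ⟨⟨fun hfree => ⟨1, le_rfl, ?_⟩, ?_⟩,
    fun hfree k hk => exists_nonlinear_syzygy_of_not_free hC3 hfree hk⟩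
  · rw [pow_one]
    have h1 : (1 : ℕ∞) ≤ sSup {r : ℕ∞ | ∃ n : ℕ, r = n ∧ IsStepLinear (edgeIdeal K C) n} :=
      le_sSup ⟨1, by simp, isStepLinear_one_of_free hC3 hfree⟩
    exact lt_of_lt_of_le (by norm_num) (add_le_add_left h1 1)
  · rintro ⟨k, hk, hindex⟩
    by_contra hfree
    -- The supremum is `0` when the set is empty or `{0}`; index above `1` therefore yields some `n
    -- ≥ 1`.
    have h0 : sSup {r : ℕ∞ | ∃ n : ℕ, r = n ∧ IsStepLinear (edgeIdeal K C ^ k) n} ≠ 0 := by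
      intro h
      rw [greenLazarsfeldIndex, h, zero_add] at hindex
      exact lt_irrefl _ hindex
    obtain ⟨_, ⟨n, rfl, d, ⟨G, hG, hspan⟩, hlin⟩, hn⟩ := lt_sSup_iff.1 (pos_iff_ne_zero.2 h0)
    have hn1 : 1 ≤ n := by
      rw [Nat.one_le_iff_ne_zero]
      rintro rfl
      simp at hn
    obtain ⟨j, hj, hne⟩ := exists_nonlinear_syzygy_of_not_free (K := K) hC3 hfree hk
    have hd : j ≤ 1 + d := by
      by_contra! hlt
      exact hne (hlin 1 hn1 j hlt)
    -- The `d` in `IsStepLinear` is not known to be `3 * k`; an element of degree `3 * k` in the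
    -- ideal gives `d ≤ 3 * k`, contradicting `3 * k + 1 < j ≤ 1 + d`.
    obtain ⟨-, -, -, -, -, T, hT, -⟩ := exists_twins_of_not_free hC3 hfree
    have hmem : monomial (k • indicatorExponent T) (1 : K) ∈ Ideal.span G := by
      rw [hspan, edgeIdeal_eq_monomialIdeal, monomialIdeal_pow]
      exact Ideal.subset_span ⟨_, nsmul_mem_iteratedSumset (A := edgeExponents C) ⟨T, hT, rfl⟩ k, rfl⟩
    have hle := degree_le_of_mem_span hG hmem (k • indicatorExponent T) (by simp)
    rw [map_nsmul, degree_indicatorExponent, hC3 T hT, smul_eq_mul] at hle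
    omega
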